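/- Conventions. $X$ is a real or complex Banach space, $X''$ its bidual, and $X$ is identified with its canonical image in $X''$. An L-projection on $X''$ with range $X$ is a bounded linear projection $P$ on $X''$ with range $X$ and $\|z\|=\|Pz\|+\|z-Pz\|$ for all $z\in X''$; $X$ is L-embedded if such a $P$ exists. A sequence $(x_n)$ of nonzero elements of $X$ spans $\ell^1$ asymptotically if there are $\delta_n\in[0,1)$ with $\delta_n\to 0$ and $$\sum_n(1-\delta_n)|\alpha_n|\le\Big\|\sum_n\alpha_n\frac{x_n}{\|x_n\|}\Big\|\le\sum_n|\alpha_n|$$ for all (finitely supported, equivalently all absolutely summable) scalar sequences $(\alpha_n)$. An abstract measure topology on $X$ is a topology $\tau$ on the set $X$ such that 1. $(X,\tau)$ is a sequential space in which every convergent sequence has a unique limit; 2. $\tau$ is weaker than (or equal to) the norm topology; 3. for every sequence $(x_n)$ in $X$ and every $x\in X$: $x_n\to x$ in $\tau$ if and only if $x_n-x\to 0$ in $\tau$; 4. every bounded sequence in $X$ that spans $\ell^1$ asymptotically $\tau$-converges to $0$, and every sequence in $X$ that $\tau$-converges to $0$ is bounded and has a subsequence which spans $\ell^1$ asymptotically or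 tends to $0$ in norm. Theorem. Let $X$ be an L-embedded Banach space with L-projection $P$ on $X''$ with range $X$. Then $X$ carries exactly one abstract measure topology; call it $\tau_\mu$. For every norm closed bounded convex set $C\subset X$ the following two assertions are equivalent: (i) $P\,\overline{C}^{w^*}=C$, where $\overline{C}^{w^*}$ is the closure of $C$ in the weak-star topology of $X''$; (ii) $C$ is $\tau_\mu$-closed. The implication (ii)$\Rightarrow$(i) holds also for every unbounded norm closed convex set $C\subset X$. -/

import Mathlib

open Filter Topology

/-- The sequence `x` of nonzero vectors spans `ℓ¹` asymptotically (isometrically): for some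
`δ n ∈ [0, 1)` tending to `0`,
`∑ (1 - δ n) |α n| ≤ ‖∑ α n • (x n / ‖x n‖)‖ ≤ ∑ |α n|` for all scalars `α n`. It is enough, and
customary, to ask this for finite sums; the inequalities then extend to summable `α`. -/
def SpansEllOneAsymptotically (𝕜 : Type*) [RCLike 𝕜] {X : Type*} [NormedAddCommGroup X]
    [NormedSpace 𝕜 X] (x : ℕ → X) : Prop :=
  (∀ n, x n ≠ 0) ∧
  ∃ δ : ℕ → ℝ, (∀ n, 0 ≤ δ n ∧ δ n < 1) ∧ Tendsto δ atTop (𝓝 0) ∧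
    ∀ (s : Finset ℕ) (α : ℕ → 𝕜),
      ∑ n ∈ s, (1 - δ n) * ‖α n‖ ≤ ‖∑ n ∈ s, α n • (((‖x n‖⁻¹ : ℝ) : 𝕜) • x n)‖ ∧
      ‖∑ n ∈ s, α n • (((‖x n‖⁻¹ : ℝ) : 𝕜) • x n)‖ ≤ ∑ n ∈ s, ‖α n‖

/-- The norm topology, under a name of its own because a second topology on `X` is in play. -/
abbrev normTopology (X : Type*) [NormedAddCommGroup X] : TopologicalSpace X :=
  UniformSpace.toTopologicalSpace

/-- `τ` is an abstract measure topology on the Banach space `X`. -/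
structure IsAbstractMeasureTopology (𝕜 : Type*) [RCLike 𝕜] {X : Type*} [NormedAddCommGroup X]
    [NormedSpace 𝕜 X] (τ : TopologicalSpace X) : Prop where
  sequential : @SequentialSpace X τ
  unique_limit : ∀ (x : ℕ → X) (a b : X),
    Tendsto x atTop (@nhds X τ a) → Tendsto x atTop (@nhds X τ b) → a = b
  weaker_than_norm : ∀ U : Set X, IsOpen[τ] U → IsOpen[normTopology X] U
  translation_invariant : ∀ (x : ℕ → X) (a : X),
    Tendsto x atTop (@nhds X τ a) ↔ Tendsto (fun n => x n - a) atTop (@nhds X τ 0)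
  tendsto_of_spans : ∀ x : ℕ → X, (∃ M : ℝ, ∀ n, ‖x n‖ ≤ M) →
    SpansEllOneAsymptotically 𝕜 x → Tendsto x atTop (@nhds X τ 0)
  bounded_of_tendsto : ∀ x : ℕ → X, Tendsto x atTop (@nhds X τ 0) → ∃ M : ℝ, ∀ n, ‖x n‖ ≤ M
  subseq_of_tendsto : ∀ x : ℕ → X, Tendsto x atTop (@nhds X τ 0) →
    ∃ φ : ℕ → ℕ, StrictMono φ ∧
      (SpansEllOneAsymptotically 𝕜 (x ∘ φ) ∨ Tendsto (fun k => ‖x (φ k)‖) atTop (𝓝 0))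

/-- `P` is an L-projection on the bidual `X''` whose range is the canonical image of `X`.
The Banach space `X` is L-embedded precisely when such a `P` exists. -/
structure IsLEmbeddingProjection (𝕜 : Type*) [RCLike 𝕜] (X : Type*) [NormedAddCommGroup X]
    [NormedSpace 𝕜 X]
    (P : StrongDual 𝕜 (StrongDual 𝕜 X) →L[𝕜] StrongDual 𝕜 (StrongDual 𝕜 X)) : Prop where
  idempotent : ∀ z, P (P z) = P z
  norm_eq : ∀ z, ‖z‖ = ‖P z‖ + ‖z - P z‖
  range_eq : Set.range P = Set.range (NormedSpace.inclusionInDoubleDual 𝕜 X)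

/-- The closure, in the weak-star topology of the bidual `X''`, of the canonical image of `C`. -/
def weakStarClosureInBidual (𝕜 : Type*) [RCLike 𝕜] {X : Type*} [NormedAddCommGroup X]
    [NormedSpace 𝕜 X] (C : Set X) : Set (StrongDual 𝕜 (StrongDual 𝕜 X)) :=
  StrongDual.toWeakDual ⁻¹'
    closure (StrongDual.toWeakDual '' (NormedSpace.inclusionInDoubleDual 𝕜 X '' C))

/-! The axioms leave no choice for the null sequences: they are the `IsMeasureNull` ones, so
sequentiality and translation give uniqueness. For existence, Kisyński's theorem turns this
convergence into a topology with exactly these convergent sequences, once limits are unique.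

The link with `P` has two halves. If a bounded sequence spans `ℓ¹` asymptotically, its weak-star
limits along free ultrafilters lie in `ker P` (`apply_eq_zero_of_asymptotic_lower_bound`). Hence a
limit of `x n` is mapped by `P` to the measure limit of `x`; this gives uniqueness of limits and
(i)⇒(ii). Conversely, a nonzero `z` in `ker P` and in the weak-star closure of a convex set is
`ℓ¹`-orthogonal to `X`, and local approximation inside the set yields a bounded asymptotic
`ℓ¹`-sequence (`exists_spansEllOneAsymptotically`). Applied to `C - a` and `z = w - a` with `a = P
w`, it exhibits `a` as a measure limit of points of `C`; this is (ii)⇒(i).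

Both halves rest on Hahn–Banach: a lower bound for the norm on a convex set persists on its
weak-star closure. -/

/-! ### Topologies generated by sequential convergence. -/

/-- The topology whose open sets are those that eventually contain every sequence converging, in
the sense of the relation `L`, to one of their points. -/
@[reducible]
def topologyOfConvergence {X : Type*} (L : (ℕ → X) → X → Prop) : TopologicalSpace X where
  IsOpen U := ∀ x a, L x a → a ∈ U → ∀ᶠ n in atTop, x n ∈ U
  isOpen_univ := fun _ _ _ _ => Eventually.of_forall fun _ => trivial
  isOpen_inter := fun _ _ hU hV x a h ha => (hU x a h ha.1).and (hV x a h ha.2)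
  isOpen_sUnion := fun _ h x a hL ⟨U, hU, ha⟩ =>
    (h U hU x a hL ha).mono fun _ hn => ⟨U, hU, hn⟩

theorem tendsto_topologyOfConvergence {X : Type*} {L : (ℕ → X) → X → Prop} {x : ℕ → X} {a : X}
    (h : L x a) : Tendsto x atTop (@nhds X (topologyOfConvergence L) a) := by
  let _ := topologyOfConvergence L
  rw [tendsto_nhds]
  exact fun U hU ha => hU x a h ha

theorem isClosed_topologyOfConvergence {X : Type*} {L : (ℕ → X) → X → Prop}
    (hsub : ∀ x a (φ : ℕ → ℕ), StrictMono φ → L x a → L (x ∘ φ) a) {A : Set X}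
    (hA : ∀ x a, (∀ n, x n ∈ A) → L x a → a ∈ A) :
    IsClosed[topologyOfConvergence L] A := by
  let _ := topologyOfConvergence L
  refine ⟨fun x a hL ha => ?_⟩
  by_contra hcon
  have hf : ∃ᶠ n in atTop, x n ∈ A := fun h => hcon (h.mono fun n hn => hn)
  obtain ⟨φ, hφ, hφA⟩ := extraction_of_frequently_atTop hf
  exact ha (hA (x ∘ φ) a hφA (hsub x a φ hφ hL))

theorem sequentialSpace_topologyOfConvergence {X : Type*} {L : (ℕ → X) → X → Prop}
    (hsub : ∀ x a (φ : ℕ → ℕ), StrictMono φ → L x a → L (x ∘ φ) a) :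
    @SequentialSpace X (topologyOfConvergence L) := by
  let _ := topologyOfConvergence L
  exact ⟨fun A hA => isClosed_topologyOfConvergence hsub fun x a hx hL =>
    hA hx (tendsto_topologyOfConvergence hL)⟩

/-- A sequence of terms of `w` either repeats a value infinitely often or shares a subsequence
with `w`. -/
theorem exists_const_or_common_subseq {X : Type*} {u w : ℕ → X} (h : ∀ n, u n ∈ Set.range w) :
    (∃ v, ∃ φ : ℕ → ℕ, StrictMono φ ∧ ∀ n, u (φ n) = v) ∨
      ∃ φ θ : ℕ → ℕ, StrictMono φ ∧ StrictMono θ ∧ u ∘ φ = w ∘ θ := by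
  by_cases hv : ∃ v, ∃ᶠ n in atTop, u n = v
  · obtain ⟨v, hv⟩ := hv
    exact Or.inl ⟨v, extraction_of_frequently_atTop hv⟩
  · right
    choose k hk using h
    have hlim : Tendsto k atTop atTop := by
      refine tendsto_atTop.2 fun m => ?_
      have hm : ∀ᶠ n in atTop, ∀ j ∈ Finset.range m, u n ≠ w j :=
        (Finset.eventually_all _).2 fun j _ => not_frequently.1 fun h => hv ⟨w j, h⟩
      filter_upwards [hm] with n hn
      by_contra! hlt
      exact hn (k n) (Finset.mem_range.2 hlt) (hk n).symm
    obtain ⟨φ, hφ, hkφ⟩ := strictMono_subseq_of_tendsto_atTop hlim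
    exact ⟨φ, k ∘ φ, hφ, hkφ, funext fun n => (hk (φ n)).symm⟩

/-- Kisyński's theorem. -/
theorem tendsto_topologyOfConvergence_iff {X : Type*} {L : (ℕ → X) → X → Prop}
    (hconst : ∀ a, L (fun _ => a) a)
    (hsub : ∀ x a (φ : ℕ → ℕ), StrictMono φ → L x a → L (x ∘ φ) a)
    (huniq : ∀ x a b, L x a → L x b → a = b)
    (hury : ∀ x a, (∀ φ : ℕ → ℕ, StrictMono φ → ∃ ψ : ℕ → ℕ, StrictMono ψ ∧ L (x ∘ φ ∘ ψ) a) →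
      L x a) (x : ℕ → X) (a : X) :
    Tendsto x atTop (@nhds X (topologyOfConvergence L) a) ↔ L x a := by
  refine ⟨fun ht => ?_, tendsto_topologyOfConvergence⟩
  refine hury x a fun φ hφ => ?_
  by_contra! hno
  let _ := topologyOfConvergence L
  -- `B` collects the limits of subsequences of `x ∘ φ ∘ θ`. Adding to it the terms other than `a`
  -- gives a closed set that misses `a`, so the terms are eventually equal to `a`, against `hno`.
  have key : ∀ (θ : ℕ → ℕ) (B : Set X), StrictMono θ → a ∉ B →
      (∀ b ∈ B, ∀ c, L (fun _ => b) c → c ∈ B) →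
      (∀ (ψ : ℕ → ℕ) (c : X), StrictMono ψ → L (x ∘ φ ∘ θ ∘ ψ) c → c ∈ B) →
      (∀ u c, (∀ n, u n ∈ B) → L u c → c ∈ B) → False := by
    intro θ B hθ haB hB1 hB2 hB3
    let A : Set X := (Set.range (x ∘ φ ∘ θ) \ {a}) ∪ B
    have hA : IsClosed A := by
      refine isClosed_topologyOfConvergence hsub fun u c hu hL => ?_
      by_cases hfB : ∃ᶠ n in atTop, u n ∈ B
      · obtain ⟨ψ, hψ, hψB⟩ := extraction_of_frequently_atTop hfB
        exact Or.inr (hB3 (u ∘ ψ) c hψB (hsub u c ψ hψ hL))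
      · have hfr : ∃ᶠ n in atTop, u n ∈ Set.range (x ∘ φ ∘ θ) \ {a} := by
          refine Eventually.frequently ((not_frequently.1 hfB).mono fun n hn => ?_)
          exact (hu n).resolve_right hn
        obtain ⟨ψ, hψ, hψA⟩ := extraction_of_frequently_atTop hfr
        have hL' := hsub u c ψ hψ hL
        rcases exists_const_or_common_subseq (u := u ∘ ψ) fun n => (hψA n).1 with
          ⟨v, η, hη, hv⟩ | ⟨η, κ, hη, hκ, he⟩
        · have hLv := hsub _ c η hη hL'
          rw [show (u ∘ ψ) ∘ η = fun _ => v from funext hv] at hLv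
          rw [huniq _ _ _ hLv (hconst v), ← hv 0]
          exact Or.inl (hψA (η 0))
        · have hLw := hsub _ c η hη hL'
          rw [he] at hLw
          exact Or.inr (hB2 κ c hκ hLw)
    have haA : a ∉ A := fun h => h.elim (fun h => h.2 rfl) haB
    have hev : ∀ᶠ n in atTop, x (φ (θ n)) ∈ Aᶜ :=
      (ht.comp (hφ.comp hθ).tendsto_atTop) (hA.isOpen_compl.mem_nhds haA)
    have hfr : ∃ᶠ n in atTop, x (φ (θ n)) = a := by
      refine Eventually.frequently (hev.mono fun n hn => ?_)
      by_contra hne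
      exact hn (Or.inl ⟨⟨n, rfl⟩, hne⟩)
    obtain ⟨ψ, hψ, hψa⟩ := extraction_of_frequently_atTop hfr
    refine hno (θ ∘ ψ) (hθ.comp hψ) ?_
    rw [show x ∘ φ ∘ θ ∘ ψ = fun _ => a from funext hψa]
    exact hconst a
  -- If some subsequence has an `L`-limit `b`, then `B = {b}` serves; if none has, `B = ∅`.
  by_cases hb : ∃ (θ : ℕ → ℕ) (b : X), StrictMono θ ∧ L (x ∘ φ ∘ θ) b
  · obtain ⟨θ, b, hθ, hb⟩ := hb
    have hab : a ≠ b := fun h => hno θ hθ (h ▸ hb)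
    refine key θ {b} hθ hab ?_ ?_ ?_
    · intro b' hb' c hc
      rw [Set.mem_singleton_iff] at hb'
      subst hb'
      exact huniq _ _ _ hc (hconst b')
    · exact fun ψ c hψ hc => huniq _ _ _ hc (hsub _ b ψ hψ hb)
    · intro u c hu hc
      rw [show u = fun _ => b from funext hu] at hc
      exact huniq _ _ _ hc (hconst b)
  · refine key id ∅ strictMono_id (fun h => h) (by simp) ?_ ?_
    · exact fun ψ c hψ hc => hb ⟨ψ, c, hψ, hc⟩
    · exact fun u c hu _ => hu 0

/-! ### Weak-star closures in the bidual. -/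

section WeakStar

variable {𝕜 : Type*} [RCLike 𝕜] {X : Type*} [NormedAddCommGroup X] [NormedSpace 𝕜 X]

theorem mem_weakStarClosureInBidual_iff {C : Set X} {z : StrongDual 𝕜 (StrongDual 𝕜 X)} :
    z ∈ weakStarClosureInBidual 𝕜 C ↔ ∀ U : Set (WeakDual 𝕜 (StrongDual 𝕜 X)), IsOpen U →
      StrongDual.toWeakDual z ∈ U →
        ∃ x ∈ C, StrongDual.toWeakDual (NormedSpace.inclusionInDoubleDual 𝕜 X x) ∈ U := by
  rw [weakStarClosureInBidual, Set.mem_preimage, mem_closure_iff]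
  refine forall_congr' fun U => forall_congr' fun _ => forall_congr' fun _ => ?_
  constructor
  · rintro ⟨_, hU, _, ⟨x, hx, rfl⟩, rfl⟩
    exact ⟨x, hx, hU⟩
  · rintro ⟨x, hx, hU⟩
    exact ⟨_, hU, _, ⟨x, hx, rfl⟩, rfl⟩

theorem continuous_weakDual_apply (f : StrongDual 𝕜 X) :
    Continuous fun w : WeakDual 𝕜 (StrongDual 𝕜 X) => w f :=
  WeakDual.eval_continuous f

theorem le_re_apply_of_mem_weakStarClosureInBidual {C : Set X}
    {z : StrongDual 𝕜 (StrongDual 𝕜 X)} (hz : z ∈ weakStarClosureInBidual 𝕜 C)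
    {f : StrongDual 𝕜 X} {r : ℝ} (h : ∀ x ∈ C, r ≤ RCLike.re (f x)) : r ≤ RCLike.re (z f) := by
  by_contra! hlt
  obtain ⟨x, hx, hxU⟩ := mem_weakStarClosureInBidual_iff.1 hz
    {w | RCLike.re (w f) < r}
    (isOpen_lt (RCLike.continuous_re.comp (continuous_weakDual_apply f)) continuous_const) hlt
  exact absurd (h x hx) (not_le.2 hxU)

theorem inclusion_mem_weakStarClosureInBidual {C : Set X} {x : X} (hx : x ∈ C) :
    NormedSpace.inclusionInDoubleDual 𝕜 X x ∈ weakStarClosureInBidual 𝕜 C :=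
  mem_weakStarClosureInBidual_iff.2 fun _ _ h => ⟨x, hx, h⟩

theorem sub_mem_weakStarClosureInBidual {C : Set X} {z : StrongDual 𝕜 (StrongDual 𝕜 X)}
    (hz : z ∈ weakStarClosureInBidual 𝕜 C) (y : X) :
    z - NormedSpace.inclusionInDoubleDual 𝕜 X y ∈
      weakStarClosureInBidual 𝕜 ((fun x => x - y) '' C) := by
  refine mem_weakStarClosureInBidual_iff.2 fun U hU hzU => ?_
  obtain ⟨x, hx, hxU⟩ := mem_weakStarClosureInBidual_iff.1 hz
    ((fun w => w - StrongDual.toWeakDual (NormedSpace.inclusionInDoubleDual 𝕜 X y)) ⁻¹' U)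
    (hU.preimage (continuous_id.sub continuous_const))  hzU
  exact ⟨x - y, ⟨x, hx, rfl⟩, by rw [map_sub]; exact hxU⟩

theorem mem_weakStarClosureInBidual_of_tendsto {ι : Type*} {l : Filter ι} [l.NeBot] {C : Set X}
    {u : ι → X} {z : StrongDual 𝕜 (StrongDual 𝕜 X)}
    (h : Tendsto (fun n => StrongDual.toWeakDual (NormedSpace.inclusionInDoubleDual 𝕜 X (u n))) l
      (𝓝 (StrongDual.toWeakDual z))) (hu : ∀ᶠ n in l, u n ∈ C) :
    z ∈ weakStarClosureInBidual 𝕜 C :=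
  mem_closure_of_tendsto (X := WeakDual 𝕜 (StrongDual 𝕜 X)) h
    (hu.mono fun n hn => ⟨_, ⟨u n, hn, rfl⟩, rfl⟩)

theorem exists_weakStar_limit (l : Ultrafilter ℕ) {u : ℕ → X} {M : ℝ} (hu : ∀ n, ‖u n‖ ≤ M) :
    ∃ z : StrongDual 𝕜 (StrongDual 𝕜 X), ‖z‖ ≤ M ∧
      Tendsto (fun n => StrongDual.toWeakDual (NormedSpace.inclusionInDoubleDual 𝕜 X (u n))) l
        (𝓝 (StrongDual.toWeakDual z)) := by
  have hc := WeakDual.isCompact_closedBall (𝕜 := 𝕜) (0 : StrongDual 𝕜 (StrongDual 𝕜 X)) M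
  have hle : (Ultrafilter.map (fun n => StrongDual.toWeakDual
      (NormedSpace.inclusionInDoubleDual 𝕜 X (u n))) l :
        Filter (WeakDual 𝕜 (StrongDual 𝕜 X))) ≤
      𝓟 (WeakDual.toStrongDual ⁻¹' Metric.closedBall 0 M) := by
    rw [le_principal_iff, Ultrafilter.mem_coe, Ultrafilter.mem_map]
    refine Filter.univ_mem' fun n => ?_
    have : NormedSpace.inclusionInDoubleDual 𝕜 X (u n) ∈
        Metric.closedBall (0 : StrongDual 𝕜 (StrongDual 𝕜 X)) M :=
      (mem_closedBall_zero_iff (E := StrongDual 𝕜 (StrongDual 𝕜 X))).2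
        ((NormedSpace.double_dual_bound 𝕜 X (u n)).trans (hu n))
    exact this
  obtain ⟨z, hz, hlim⟩ := hc.ultrafilter_le_nhds _ hle
  refine ⟨WeakDual.toStrongDual z, ?_, hlim⟩
  simpa using hz

theorem exists_re_apply_gt (w : StrongDual 𝕜 (StrongDual 𝕜 X)) {η : ℝ} (hη : 0 < η) :
    ∃ f : StrongDual 𝕜 X, ‖f‖ ≤ 1 ∧ ‖w‖ - η < RCLike.re (w f) := by
  rcases lt_or_ge (‖w‖ - η) 0 with h | h
  · exact ⟨0, by simp, by simpa using h⟩
  · lift ‖w‖ - η to NNReal using h with r hr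
    obtain ⟨g, hg, hlt⟩ := w.exists_lt_apply_of_lt_opNNNorm (r := r) (by
      rw [← NNReal.coe_lt_coe, hr, coe_nnnorm]; linarith)
    obtain ⟨c, hc, hcw⟩ := RCLike.exists_norm_eq_mul_self (w g)
    refine ⟨c • g, ?_, ?_⟩
    · rw [norm_smul, hc, one_mul]
      exact le_of_lt (by exact_mod_cast hg)
    · rw [map_smul, smul_eq_mul, ← hcw, RCLike.ofReal_re]
      exact_mod_cast hlt

variable [NormedSpace ℝ X] [IsScalarTower ℝ 𝕜 X]

theorem re_apply_real_smul (f : StrongDual 𝕜 X) (a : ℝ) (x : X) :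
    RCLike.re (f (a • x)) = a * RCLike.re (f x) := by
  rw [← RCLike.re_ofReal_mul, ← smul_eq_mul, ← map_smul, algebraMap_smul]

/-- The norm of the bidual is weak-star lower semicontinuous along convex sets. -/
theorem le_norm_of_mem_weakStarClosureInBidual {D : Set X} (hD : Convex ℝ D)
    {z : StrongDual 𝕜 (StrongDual 𝕜 X)} (hz : z ∈ weakStarClosureInBidual 𝕜 D) {r : ℝ}
    (h : ∀ x ∈ D, r ≤ ‖x‖) : r ≤ ‖z‖ := by
  rcases le_or_gt r 0 with hr | hr
  · exact hr.trans (norm_nonneg z)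
  obtain ⟨f, s, hfs, hsf⟩ := RCLike.geometric_hahn_banach_open (𝕜 := 𝕜) (convex_ball (0 : X) r)
    Metric.isOpen_ball hD (Set.disjoint_left.2 fun x hx hxD =>
      absurd (h x hxD) (not_le.2 (by simpa using hx)))
  have hs : s ≤ RCLike.re (z f) := le_re_apply_of_mem_weakStarClosureInBidual hz hsf
  have hs0 : 0 < s := by simpa using hfs 0 (Metric.mem_ball_self hr)
  have hzf : RCLike.re (z f) ≤ ‖z‖ * ‖f‖ := (RCLike.re_le_norm _).trans (z.le_opNorm f)
  have hf0 : 0 < ‖f‖ := by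
    by_contra! hf
    have : ‖f‖ = 0 := le_antisymm hf (norm_nonneg f)
    rw [this, mul_zero] at hzf
    linarith
  -- The supremum of `re f` over the ball of radius `r` is `r * ‖f‖`.
  have hrf : r * ‖f‖ ≤ s := by
    by_contra! hlt
    obtain ⟨g, hg, hlt'⟩ := f.exists_lt_apply_of_lt_opNorm ((div_lt_iff₀' hr).2 hlt)
    obtain ⟨c, hc, hcf⟩ := RCLike.exists_norm_eq_mul_self (f g)
    have hball : r • c • g ∈ Metric.ball (0 : X) r := by
      rw [mem_ball_zero_iff, norm_smul, norm_smul, hc, one_mul, Real.norm_of_nonneg hr.le]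
      exact mul_lt_of_lt_one_right hr hg
    have := hfs _ hball
    rw [re_apply_real_smul, map_smul, smul_eq_mul, ← hcf, RCLike.ofReal_re] at this
    exact absurd ((div_lt_iff₀' hr).1 hlt') (not_lt.2 this.le)
  exact le_of_mul_le_mul_right (hrf.trans (hs.trans hzf)) hf0

end WeakStar

/-! ### Convex hulls of tails of asymptotic `ℓ¹`-sequences. -/

section TailHull

variable {X : Type*} [NormedAddCommGroup X] [NormedSpace ℝ X]

theorem convex_image_sub {C : Set X} (hC : Convex ℝ C) (a : X) :
    Convex ℝ ((fun x => x - a) '' C) := by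
  simpa only [sub_eq_neg_add] using hC.translate (-a)

/-- The convex combinations of the terms `u n` with `m ≤ n`. -/
def tailHull (u : ℕ → X) (m : ℕ) : Set X :=
  Finsupp.linearCombination ℝ u '' {α | (∀ n, 0 ≤ α n) ∧ (∀ n < m, α n = 0) ∧
    Finsupp.linearCombination ℝ (fun _ => (1 : ℝ)) α = 1}

theorem convex_tailHull (u : ℕ → X) (m : ℕ) : Convex ℝ (tailHull u m) := by
  refine Convex.linear_image ?_ _
  rintro α ⟨h1, h2, h3⟩ β ⟨k1, k2, k3⟩ a b ha hb hab
  refine ⟨fun n => ?_, fun n hn => ?_, ?_⟩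
  · have := h1 n
    have := k1 n
    simp only [Finsupp.add_apply, Finsupp.smul_apply, smul_eq_mul]
    positivity
  · simp [h2 n hn, k2 n hn]
  · rw [map_add, map_smul, map_smul, h3, k3]
    simpa using hab

theorem mem_tailHull (u : ℕ → X) {m n : ℕ} (h : m ≤ n) : u n ∈ tailHull u m := by
  refine ⟨Finsupp.single n 1, ⟨fun k => ?_, fun k hk => ?_, by simp⟩, by simp⟩
  · rw [Finsupp.single_apply]
    positivity
  · rw [Finsupp.single_apply, if_neg (by omega)]

theorem linearCombination_eq_sum_of_subset {Y : Type*} [AddCommGroup Y] [Module ℝ Y] (v : ℕ → Y)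
    {γ : ℕ →₀ ℝ} {s : Finset ℕ} (h : γ.support ⊆ s) :
    Finsupp.linearCombination ℝ v γ = ∑ n ∈ s, γ n • v n := by
  rw [Finsupp.linearCombination_apply]
  exact Finsupp.sum_of_support_subset _ h _ (by simp)

/-- For a normalised sequence with asymptotic lower `ℓ¹`-estimates, convex combinations far out
are almost at distance `2` from a given one. -/
theorem exists_le_norm_sub_of_mem_tailHull {𝕜 : Type*} [RCLike 𝕜] [NormedSpace 𝕜 X]
    [IsScalarTower ℝ 𝕜 X] {u : ℕ → X} {δ : ℕ → ℝ}
    (hlow : ∀ (s : Finset ℕ) (α : ℕ → 𝕜), ∑ n ∈ s, (1 - δ n) * ‖α n‖ ≤ ‖∑ n ∈ s, α n • u n‖)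
    {ε : ℝ} {m : ℕ} (hm : ∀ n, m ≤ n → δ n ≤ ε) {y : X} (hy : y ∈ tailHull u m) :
    ∃ N, ∀ x ∈ tailHull u N, 2 * (1 - ε) ≤ ‖x - y‖ := by
  obtain ⟨α, ⟨hα0, hαm, hα1⟩, rfl⟩ := hy
  obtain ⟨N, hN⟩ : ∃ N, ∀ n, N ≤ n → n ∉ α.support := by
    obtain ⟨N, hN⟩ := α.support.bddAbove
    exact ⟨N + 1, fun n hn h => by have := hN h; omega⟩
  -- Beyond `N` the supports of `α` and `β` are disjoint, so `β - α` has `ℓ¹`-norm `2`; beyond `m`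
  -- the loss `δ` is at most `ε`.
  refine ⟨max m N, ?_⟩
  rintro _ ⟨β, ⟨hβ0, hβm, hβ1⟩, rfl⟩
  let s := α.support ∪ β.support
  have hαs : α.support ⊆ s := Finset.subset_union_left
  have hβs : β.support ⊆ s := Finset.subset_union_right
  have key := hlow s fun n => ((β n - α n : ℝ) : 𝕜)
  have e1 : ∑ n ∈ s, ((β n - α n : ℝ) : 𝕜) • u n =
      Finsupp.linearCombination ℝ u β - Finsupp.linearCombination ℝ u α := by
    rw [linearCombination_eq_sum_of_subset u hαs, linearCombination_eq_sum_of_subset u hβs,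
      ← Finset.sum_sub_distrib]
    refine Finset.sum_congr rfl fun n _ => ?_
    rw [← sub_smul, ← algebraMap_smul 𝕜 (β n - α n) (u n)]
  rw [e1] at key
  refine le_trans ?_ key
  rw [linearCombination_eq_sum_of_subset _ hαs] at hα1
  rw [linearCombination_eq_sum_of_subset _ hβs] at hβ1
  have e2 : 2 * (1 - ε) = ∑ n ∈ s, (1 - ε) * (α n + β n) := by
    simp only [smul_eq_mul, mul_one] at hα1 hβ1
    rw [← Finset.mul_sum, Finset.sum_add_distrib, hα1, hβ1]
    ring
  rw [e2]
  refine Finset.sum_le_sum fun n _ => ?_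
  rw [RCLike.norm_ofReal]
  rcases lt_or_ge n m with h | h
  · simp [hαm n h, hβm n (lt_max_of_lt_left h)]
  · have hab : |β n - α n| = α n + β n := by
      rcases lt_or_ge n N with h' | h'
      · rw [hβm n (lt_max_of_lt_right h'), zero_sub, abs_neg, abs_of_nonneg (hα0 n), add_zero]
      · rw [Finsupp.notMem_support_iff.1 (hN n h'), sub_zero, abs_of_nonneg (hβ0 n), zero_add]
    rw [hab]
    have := hm n h
    exact mul_le_mul_of_nonneg_right (by linarith) (add_nonneg (hα0 n) (hβ0 n))

end TailHull

/-! ### Asymptotic `ℓ¹`-sequences have singular limits. -/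

namespace IsLEmbeddingProjection

variable {𝕜 : Type*} [RCLike 𝕜] {X : Type*} [NormedAddCommGroup X] [NormedSpace 𝕜 X]
  {P : StrongDual 𝕜 (StrongDual 𝕜 X) →L[𝕜] StrongDual 𝕜 (StrongDual 𝕜 X)}

theorem apply_inclusion (hP : IsLEmbeddingProjection 𝕜 X P) (x : X) :
    P (NormedSpace.inclusionInDoubleDual 𝕜 X x) = NormedSpace.inclusionInDoubleDual 𝕜 X x := by
  obtain ⟨w, hw⟩ : NormedSpace.inclusionInDoubleDual 𝕜 X x ∈ Set.range P :=
    hP.range_eq ▸ Set.mem_range_self x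
  rw [← hw, hP.idempotent]

theorem exists_inclusion_eq (hP : IsLEmbeddingProjection 𝕜 X P)
    (z : StrongDual 𝕜 (StrongDual 𝕜 X)) :
    ∃ x, NormedSpace.inclusionInDoubleDual 𝕜 X x = P z := by
  have : P z ∈ Set.range (NormedSpace.inclusionInDoubleDual 𝕜 X) :=
    hP.range_eq ▸ Set.mem_range_self z
  exact this

theorem norm_inclusion (x : X) : ‖NormedSpace.inclusionInDoubleDual 𝕜 X x‖ = ‖x‖ :=
  (NormedSpace.inclusionInDoubleDualLi 𝕜).norm_map x

theorem norm_inclusion_sub (x y : X) : ‖NormedSpace.inclusionInDoubleDual 𝕜 X x -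
    NormedSpace.inclusionInDoubleDual 𝕜 X y‖ = ‖x - y‖ := by
  rw [← map_sub (NormedSpace.inclusionInDoubleDual 𝕜 X), norm_inclusion]

/-- The norm is additive between `X` and the kernel of the projection. -/
theorem norm_sub_inclusion (hP : IsLEmbeddingProjection 𝕜 X P)
    {z : StrongDual 𝕜 (StrongDual 𝕜 X)} {x : X}
    (hx : NormedSpace.inclusionInDoubleDual 𝕜 X x = P z) (y : X) :
    ‖z - NormedSpace.inclusionInDoubleDual 𝕜 X y‖ =
      ‖x - y‖ + ‖z - NormedSpace.inclusionInDoubleDual 𝕜 X x‖ := by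
  have h : z - NormedSpace.inclusionInDoubleDual 𝕜 X y -
      (P z - NormedSpace.inclusionInDoubleDual 𝕜 X y) = z - P z := by
    ext
    simp
  rw [hP.norm_eq, map_sub P, hP.apply_inclusion, h, ← hx, norm_inclusion_sub]

variable [NormedSpace ℝ X] [IsScalarTower ℝ 𝕜 X]

/-- Weak-star limit points of a normalised sequence with asymptotic lower `ℓ¹`-estimates are
singular. -/
theorem apply_eq_zero_of_asymptotic_lower_bound (hP : IsLEmbeddingProjection 𝕜 X P) {u : ℕ → X}
    {δ : ℕ → ℝ} (hδ : Tendsto δ atTop (𝓝 0))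
    (hlow : ∀ (s : Finset ℕ) (α : ℕ → 𝕜), ∑ n ∈ s, (1 - δ n) * ‖α n‖ ≤ ‖∑ n ∈ s, α n • u n‖)
    {l : Filter ℕ} [l.NeBot] (hl : l ≤ atTop) {z : StrongDual 𝕜 (StrongDual 𝕜 X)} (hz1 : ‖z‖ ≤ 1)
    (hz : Tendsto (fun n => StrongDual.toWeakDual (NormedSpace.inclusionInDoubleDual 𝕜 X (u n))) l
      (𝓝 (StrongDual.toWeakDual z))) : P z = 0 := by
  obtain ⟨x, hx⟩ := hP.exists_inclusion_eq z
  have hmem : ∀ m, z ∈ weakStarClosureInBidual 𝕜 (tailHull u m) := fun m =>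
    mem_weakStarClosureInBidual_of_tendsto hz
      (hl ((eventually_ge_atTop m).mono fun n hn => mem_tailHull u hn))
  have hsing : ‖z - NormedSpace.inclusionInDoubleDual 𝕜 X x‖ ≤ 1 - ‖x‖ := by
    have := hP.norm_eq z
    rw [← hx, norm_inclusion] at this
    linarith
  have hsmall : ∀ ε : ℝ, 0 < ε → ‖x‖ ≤ ε := by
    intro ε hε
    obtain ⟨m, hm⟩ := eventually_atTop.1 (hδ.eventually (ge_mem_nhds hε))
    -- The norm bound is passed to the weak-star limit twice. Here `‖z - y‖ ≥ 2 * (1 - ε)` splits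
    -- along `P` into `‖x - y‖` and a singular part of norm at most `1 - ‖x‖`. Letting `y` tend to
    -- `z` then gives `‖z - x‖ ≥ 1 - 2 * ε + ‖x‖`, which `hsing` turns into `‖x‖ ≤ ε`.
    have hfar : ∀ w ∈ (fun y => y - x) '' tailHull u m, 1 - 2 * ε + ‖x‖ ≤ ‖w‖ := by
      rintro _ ⟨y, hy, rfl⟩
      obtain ⟨N, hN⟩ := exists_le_norm_sub_of_mem_tailHull hlow hm hy
      have h2 : 2 * (1 - ε) ≤ ‖z - NormedSpace.inclusionInDoubleDual 𝕜 X y‖ :=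
        le_norm_of_mem_weakStarClosureInBidual (convex_image_sub (convex_tailHull u N) y)
          (sub_mem_weakStarClosureInBidual (hmem N) y) (by
            rintro _ ⟨w, hw, rfl⟩
            exact hN w hw)
      rw [hP.norm_sub_inclusion hx, norm_sub_rev] at h2
      linarith
    have := le_norm_of_mem_weakStarClosureInBidual (convex_image_sub (convex_tailHull u m) x)
      (sub_mem_weakStarClosureInBidual (hmem m) x) hfar
    linarith
  have hx0 : ‖x‖ ≤ 0 := le_of_forall_gt_imp_ge_of_dense hsmall
  rw [← hx, norm_le_zero_iff.1 hx0, map_zero]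

/-- Along the ultrafilter the bounded norms converge to some `c` and the normalised vectors to a
singular `z`; the limit is `c • z`. -/
theorem exists_singular_weakStar_limit (hP : IsLEmbeddingProjection 𝕜 X P) {y : ℕ → X} {M : ℝ}
    (hM : ∀ n, ‖y n‖ ≤ M)
    (hy : SpansEllOneAsymptotically 𝕜 y ∨ Tendsto (fun n => ‖y n‖) atTop (𝓝 0))
    {l : Ultrafilter ℕ} (hl : (l : Filter ℕ) ≤ atTop) :
    ∃ z, P z = 0 ∧
      Tendsto (fun n => StrongDual.toWeakDual (NormedSpace.inclusionInDoubleDual 𝕜 X (y n))) l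
        (𝓝 (StrongDual.toWeakDual z)) := by
  rcases hy with ⟨hne, δ, _, hδ0, hspan⟩ | h0
  · have hunit : ∀ n, ‖((‖y n‖⁻¹ : ℝ) : 𝕜) • y n‖ ≤ 1 := by
      intro n
      rw [norm_smul, RCLike.norm_ofReal, abs_inv, abs_norm,
        inv_mul_cancel₀ (norm_ne_zero_iff.2 (hne n))]
    obtain ⟨z, hz1, hz⟩ := exists_weakStar_limit (𝕜 := 𝕜) l hunit
    obtain ⟨c, -, hc⟩ := (isCompact_Icc (a := (0 : ℝ)) (b := M)).ultrafilter_le_nhds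
      (l.map fun n : ℕ => ‖y n‖) (le_principal_iff.2 (mem_map.2 <| Filter.univ_mem' fun n =>
        ⟨norm_nonneg _, hM n⟩))
    refine ⟨(c : 𝕜) • z, ?_, ?_⟩
    · rw [map_smul, hP.apply_eq_zero_of_asymptotic_lower_bound hδ0
        (fun s α => (hspan s α).1) hl hz1 hz]
      exact smul_zero (M := 𝕜) (A := StrongDual 𝕜 (StrongDual 𝕜 X)) _
    · have hc' : Tendsto (fun n => ((‖y n‖ : ℝ) : 𝕜)) l (𝓝 (c : 𝕜)) :=
        (RCLike.continuous_ofReal.tendsto c).comp hc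
      have := hc'.smul hz
      rw [map_smul]
      refine this.congr fun n => ?_
      rw [← map_smul, ← map_smul, smul_smul, ← RCLike.ofReal_mul,
        mul_inv_cancel₀ (norm_ne_zero_iff.2 (hne n)), RCLike.ofReal_one, one_smul]
  · refine ⟨0, map_zero _, ?_⟩
    have h1 := ((NormedSpace.Dual.toWeakDual_continuous (𝕜 := 𝕜) (E := StrongDual 𝕜 X)).comp
      (NormedSpace.inclusionInDoubleDual 𝕜 X).continuous).tendsto 0
    have h2 := h1.comp ((tendsto_zero_iff_norm_tendsto_zero.2 h0).mono_left hl)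
    simpa [Function.comp_def] using h2

end IsLEmbeddingProjection

/-! ### Asymptotic `ℓ¹`-sequences from singular functionals. -/

section SingularApproximation

variable {𝕜 : Type*} [RCLike 𝕜] {X : Type*} [NormedAddCommGroup X] [NormedSpace 𝕜 X]
  [NormedSpace ℝ X] [IsScalarTower ℝ 𝕜 X]
  {P : StrongDual 𝕜 (StrongDual 𝕜 X) →L[𝕜] StrongDual 𝕜 (StrongDual 𝕜 X)}

theorem convex_re_gt {C : Set X} (hC : Convex ℝ C) (t : Finset X) (f : X → StrongDual 𝕜 X)
    (c : X → ℝ) : Convex ℝ {x | x ∈ C ∧ ∀ y ∈ t, c y < RCLike.re (f y x)} := by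
  rintro x ⟨hxC, hx⟩ x' ⟨hxC', hx'⟩ a b ha hb hab
  refine ⟨hC hxC hxC' ha hb hab, fun y hy => ?_⟩
  rw [map_add, map_add, re_apply_real_smul, re_apply_real_smul]
  have h := convex_Ioi (c y) (hx y hy) (hx' y hy) ha hb hab
  simpa using h

/-- Elements of a convex set that are weak-star close to a singular functional are almost
`ℓ¹`-orthogonal to a given finite-dimensional subspace. -/
theorem IsLEmbeddingProjection.exists_almost_additive (hP : IsLEmbeddingProjection 𝕜 X P)
    {C : Set X} (hC : Convex ℝ C) {z : StrongDual 𝕜 (StrongDual 𝕜 X)}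
    (hz : z ∈ weakStarClosureInBidual 𝕜 C) (hPz : P z = 0) (hz0 : 0 < ‖z‖)
    (F : Submodule 𝕜 X) [FiniteDimensional 𝕜 F] {ε : ℝ} (hε : 0 < ε) (hε1 : ε ≤ 1) :
    ∃ x ∈ C, x ≠ 0 ∧ ‖x‖ ≤ 2 * ‖z‖ ∧ ∀ y ∈ F, (1 - ε) * (‖y‖ + ‖x‖) ≤ ‖y + x‖ := by
  set η : ℝ := ε * ‖z‖ / 10 with hη
  have hη0 : 0 < η := by positivity
  have hηz : 10 * η ≤ ‖z‖ := by
    rw [hη]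
    nlinarith
  have hadd : ∀ y : X, ‖z + NormedSpace.inclusionInDoubleDual 𝕜 X y‖ = ‖y‖ + ‖z‖ := by
    intro y
    have h : P (z + NormedSpace.inclusionInDoubleDual 𝕜 X y) =
        NormedSpace.inclusionInDoubleDual 𝕜 X y := by
      rw [map_add P, hPz, hP.apply_inclusion]
      ext
      simp
    have h' : z + NormedSpace.inclusionInDoubleDual 𝕜 X y -
        NormedSpace.inclusionInDoubleDual 𝕜 X y = z := by
      ext
      simp
    rw [hP.norm_eq, h, h', IsLEmbeddingProjection.norm_inclusion]
  choose f hf1 hf using fun y : X =>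
    exists_re_apply_gt (z + NormedSpace.inclusionInDoubleDual 𝕜 X y) hη0
  have hf' : ∀ y, ‖y‖ + ‖z‖ - η < RCLike.re (z (f y)) + RCLike.re (f y y) := by
    intro y
    have := hf y
    rw [hadd] at this
    rwa [← map_add]
  -- For `‖y‖ > R` the triangle inequality suffices, since `2 * ‖x‖ ≤ 4 * ‖z‖ ≤ ε * ‖y‖`. Only a
  -- compact ball of `F` remains, where finitely many `f y` almost norm all `z + y'`.
  set R : ℝ := 4 * ‖z‖ / ε with hR
  have hK : IsCompact (Subtype.val '' Metric.closedBall (0 : F) R) := by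
    have : ProperSpace F := FiniteDimensional.proper_rclike 𝕜 F
    exact (isCompact_closedBall _ _).image continuous_subtype_val
  obtain ⟨t, -, ht⟩ := hK.elim_nhds_subcover
    (fun y => {y' | ‖y'‖ + ‖z‖ - η < RCLike.re (z (f y)) + RCLike.re (f y y')}) fun y _ =>
      IsOpen.mem_nhds (isOpen_lt (by fun_prop)
        (continuous_const.add (RCLike.continuous_re.comp (f y).continuous))) (hf' y)
  set D : Set X := {x | x ∈ C ∧ ∀ y ∈ t, RCLike.re (z (f y)) - η < RCLike.re (f y x)}
  have hDconv : Convex ℝ D := convex_re_gt hC t f _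
  have hzD : z ∈ weakStarClosureInBidual 𝕜 D := by
    refine mem_weakStarClosureInBidual_iff.2 fun U hU hzU => ?_
    obtain ⟨x, hxC, hxU, hx⟩ := mem_weakStarClosureInBidual_iff.1 hz
      (U ∩ ⋂ y ∈ t, {w | RCLike.re (z (f y)) - η < RCLike.re (w (f y))})
      (hU.inter (isOpen_biInter_finset fun y _ => isOpen_lt continuous_const
        (RCLike.continuous_re.comp (continuous_weakDual_apply (f y)))))
      ⟨hzU, Set.mem_iInter₂.2 fun y _ => sub_lt_self _ hη0⟩
    exact ⟨x, ⟨hxC, fun y hy => Set.mem_iInter₂.1 hx y hy⟩, hxU⟩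
  -- Were all norms on `D` at least `‖z‖ + η`, so would be the norm of `z`, which lies in the
  -- weak-star closure of the convex set `D`.
  obtain ⟨x, ⟨hxC, hxt⟩, hxz⟩ : ∃ x ∈ D, ‖x‖ < ‖z‖ + η := by
    by_contra! h
    have := le_norm_of_mem_weakStarClosureInBidual hDconv hzD h
    linarith
  have hnear : ∀ y ∈ F, ‖y‖ ≤ R → ‖y‖ + ‖z‖ - 2 * η ≤ ‖y + x‖ := by
    intro y hy hyR
    have hyK : y ∈ Subtype.val '' Metric.closedBall (0 : F) R :=
      ⟨⟨y, hy⟩, by simpa using hyR, rfl⟩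
    obtain ⟨y', hy't, hy'⟩ := Set.mem_iUnion₂.1 (ht hyK)
    have h1 := hxt y' hy't
    have h2 : RCLike.re (f y' (y + x)) ≤ ‖y + x‖ :=
      (RCLike.re_le_norm _).trans (((f y').le_opNorm _).trans
        (mul_le_of_le_one_left (norm_nonneg _) (hf1 y')))
    rw [map_add, map_add] at h2
    have h3 : ‖y‖ + ‖z‖ - η < RCLike.re (z (f y')) + RCLike.re (f y' y) := hy'
    linarith
  have hRε : ε * R = 4 * ‖z‖ := by
    rw [hR]
    field_simp
  have hxlow : ‖z‖ - 2 * η ≤ ‖x‖ := by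
    have := hnear 0 F.zero_mem (by rw [norm_zero]; positivity)
    simpa using this
  refine ⟨x, hxC, ?_, by linarith, fun y hy => ?_⟩
  · rw [← norm_pos_iff]
    linarith
  · rcases le_or_gt ‖y‖ R with h | h
    · have := hnear y hy h
      have h10 : 10 * η = ε * ‖z‖ := by rw [hη]; ring
      nlinarith [norm_nonneg y]
    · have h1 : ‖y‖ - ‖x‖ ≤ ‖y + x‖ := by
        have := norm_sub_norm_le y (-x)
        rwa [norm_neg, sub_neg_eq_add] at this
      have h2 : 4 * ‖z‖ ≤ ε * ‖y‖ := by
        rw [← hRε]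
        exact mul_le_mul_of_nonneg_left h.le hε.le
      nlinarith [norm_nonneg x]

/-- Every nonzero singular functional in the weak-star closure of a convex set produces a bounded
sequence in this set which spans `ℓ¹` asymptotically. -/
theorem IsLEmbeddingProjection.exists_spansEllOneAsymptotically
    (hP : IsLEmbeddingProjection 𝕜 X P) {C : Set X} (hC : Convex ℝ C)
    {z : StrongDual 𝕜 (StrongDual 𝕜 X)} (hz : z ∈ weakStarClosureInBidual 𝕜 C)
    (hPz : P z = 0) (hz0 : 0 < ‖z‖) :
    ∃ x : ℕ → X, (∀ n, x n ∈ C) ∧ (∀ n, ‖x n‖ ≤ 2 * ‖z‖) ∧ SpansEllOneAsymptotically 𝕜 x := by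
  classical
  -- The product of the `1 - ε k` over `k ≥ n` telescopes to `1 - 1 / (n + 2)`, whence `δ n = 1 / (n
  -- + 2)` below.
  let ε : ℕ → ℝ := fun n => 1 / ((n : ℝ) + 2) ^ 2
  have hε : ∀ n, 0 < ε n ∧ ε n ≤ 1 := fun n => by
    refine ⟨by positivity, ?_⟩
    rw [div_le_one (by positivity)]
    nlinarith [n.cast_nonneg (α := ℝ)]
  choose g hgC hg0 hgz hg using fun (S : Finset X) (n : ℕ) =>
    hP.exists_almost_additive hC hz hPz hz0 (Submodule.span 𝕜 (S : Set X)) (hε n).1 (hε n).2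
  -- `S n` holds the vectors chosen before stage `n`; the next one is almost `ℓ¹`-orthogonal to
  -- their span.
  obtain ⟨S, hS⟩ : ∃ S : ℕ → Finset X, ∀ n, S (n + 1) = insert (g (S n) n) (S n) :=
    ⟨fun n => Nat.rec ∅ (fun n T => insert (g T n) T) n, fun _ => rfl⟩
  have hSmono : Monotone S := monotone_nat_of_le_succ fun n => by
    rw [hS]
    exact Finset.subset_insert _ _
  let x : ℕ → X := fun n => g (S n) n
  have hx0 : ∀ n, x n ≠ 0 := fun n => hg0 _ _
  have hxS : ∀ {j n}, j < n → x j ∈ S n := fun {j n} h =>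
    hSmono (Nat.succ_le_of_lt h) (by rw [hS]; exact Finset.mem_insert_self _ _)
  refine ⟨x, fun n => hgC _ _, fun n => hgz _ _, hx0, fun n => 1 / ((n : ℝ) + 2), fun n => ?_, ?_,
    fun s α => ⟨?_, ?_⟩⟩
  · refine ⟨by positivity, ?_⟩
    rw [div_lt_one (by positivity)]
    linarith [n.cast_nonneg (α := ℝ)]
  · have := (tendsto_one_div_add_atTop_nhds_zero_nat (𝕜 := ℝ)).comp (tendsto_add_atTop_nat 1)
    refine this.congr fun n => ?_
    simp only [Function.comp_apply]
    push_cast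
    ring_nf
  · let u : ℕ → X := fun n => ((‖x n‖⁻¹ : ℝ) : 𝕜) • x n
    have hstep : ∀ n : ℕ, ∀ y ∈ Submodule.span 𝕜 (S n : Set X), ∀ a : 𝕜,
        (1 - ε n) * (‖y‖ + ‖a‖) ≤ ‖y + a • u n‖ := by
      intro n y hy a
      rcases eq_or_ne a 0 with rfl | ha
      · have h1 := (hε n).1
        rw [norm_zero, add_zero, zero_smul, add_zero]
        exact mul_le_of_le_one_left (norm_nonneg y) (by linarith)
      · have hxn : 0 < ‖x n‖ := norm_pos_iff.2 (hx0 n)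
        obtain ⟨b, hb⟩ : ∃ b : 𝕜, b = a * ((‖x n‖⁻¹ : ℝ) : 𝕜) := ⟨_, rfl⟩
        have hbx : ‖b‖ * ‖x n‖ = ‖a‖ := by
          rw [hb, norm_mul, RCLike.norm_ofReal, abs_inv, abs_norm, mul_assoc,
            inv_mul_cancel₀ hxn.ne', mul_one]
        have hb0 : b ≠ 0 := by
          rintro rfl
          rw [norm_zero, zero_mul] at hbx
          exact ha (norm_eq_zero.1 hbx.symm)
        have h1 : y + a • u n = b • (b⁻¹ • y + x n) := by
          rw [smul_add, smul_inv_smul₀ hb0, hb, mul_smul]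
        have h2 := hg (S n) n (b⁻¹ • y) (Submodule.smul_mem _ _ hy)
        rw [norm_smul, norm_inv] at h2
        have h3 := mul_le_mul_of_nonneg_left h2 (norm_nonneg b)
        rw [h1, norm_smul]
        refine le_trans (le_of_eq ?_) h3
        rw [← hbx]
        have hb0' := norm_ne_zero_iff.2 hb0
        field_simp
        rfl
    -- The factor on the right is the product of all losses still to come; keeping it there lets the
    -- induction close.
    have hind : ∀ (β : ℕ → 𝕜) (n : ℕ), ∑ j ∈ Finset.range n, (1 - 1 / ((j : ℝ) + 2)) * ‖β j‖ ≤
        (1 - 1 / ((n : ℝ) + 2)) * ‖∑ j ∈ Finset.range n, β j • u j‖ := by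
      intro β n
      induction n with
      | zero => simp
      | succ n ih =>
        rw [Finset.sum_range_succ, Finset.sum_range_succ]
        have hmem : ∑ j ∈ Finset.range n, β j • u j ∈ Submodule.span 𝕜 (S n : Set X) :=
          Submodule.sum_mem _ fun j hj => Submodule.smul_mem _ _ (Submodule.smul_mem _ _
            (Submodule.subset_span (hxS (Finset.mem_range.1 hj))))
        have h1 := hstep n _ hmem (β n)
        have h2 : 1 - 1 / ((n : ℝ) + 2) = (1 - 1 / (((n + 1 : ℕ) : ℝ) + 2)) * (1 - ε n) := by
          simp only [ε]
          push_cast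
          field_simp
          ring
        have h3 : (0 : ℝ) ≤ 1 - 1 / (((n + 1 : ℕ) : ℝ) + 2) := by
          rw [sub_nonneg, div_le_one (by positivity)]
          linarith [(n + 1).cast_nonneg (α := ℝ)]
        refine le_trans ?_ (mul_le_mul_of_nonneg_left h1 h3)
        rw [← mul_assoc, ← h2, mul_add]
        exact add_le_add_left ih _
    obtain ⟨N, hN⟩ : ∃ N, s ⊆ Finset.range N := s.exists_nat_subset_range
    have key := hind (fun n => if n ∈ s then α n else 0) N
    simp only [ite_smul, zero_smul, apply_ite norm, norm_zero, mul_ite, mul_zero,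
      Finset.sum_ite_mem, Finset.inter_eq_right.2 hN] at key
    refine key.trans (mul_le_of_le_one_left (norm_nonneg _) ?_)
    have : (0 : ℝ) ≤ 1 / ((N : ℝ) + 2) := by positivity
    linarith
  · refine (norm_sum_le _ _).trans (Finset.sum_le_sum fun n _ => ?_)
    rw [norm_smul, norm_smul, RCLike.norm_ofReal, abs_inv, abs_norm,
        inv_mul_cancel₀ (norm_ne_zero_iff.2 (hx0 n)), mul_one]

end SingularApproximation

/-! ### Null sequences; existence and uniqueness of the topology. -/

section NullSequences

variable {𝕜 : Type*} [RCLike 𝕜] {X : Type*} [NormedAddCommGroup X] [NormedSpace 𝕜 X]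

theorem SpansEllOneAsymptotically.comp {x : ℕ → X} (h : SpansEllOneAsymptotically 𝕜 x)
    {φ : ℕ → ℕ} (hφ : StrictMono φ) : SpansEllOneAsymptotically 𝕜 (x ∘ φ) := by
  obtain ⟨hne, δ, hδ, hδ0, hspan⟩ := h
  refine ⟨fun n => hne _, δ ∘ φ, fun n => hδ _, hδ0.comp hφ.tendsto_atTop, fun s α => ?_⟩
  have := hspan (s.map ⟨φ, hφ.injective⟩) (Function.extend φ α 0)
  simpa only [Finset.sum_map, Function.Embedding.coeFn_mk, hφ.injective.extend_apply,
    Function.comp_apply] using this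

/-- The sequence spans `ℓ¹` asymptotically or tends to `0` in norm. -/
def SpansOrTendstoZero (𝕜 : Type*) [RCLike 𝕜] {X : Type*} [NormedAddCommGroup X]
    [NormedSpace 𝕜 X] (x : ℕ → X) : Prop :=
  SpansEllOneAsymptotically 𝕜 x ∨ Tendsto (fun n => ‖x n‖) atTop (𝓝 0)

theorem SpansOrTendstoZero.comp {x : ℕ → X} (h : SpansOrTendstoZero 𝕜 x)
    {φ : ℕ → ℕ} (hφ : StrictMono φ) : SpansOrTendstoZero 𝕜 (x ∘ φ) :=
  h.imp (fun h => h.comp hφ) fun h => h.comp hφ.tendsto_atTop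

/-- The null sequences of the abstract measure topology. -/
def IsMeasureNull (𝕜 : Type*) [RCLike 𝕜] {X : Type*} [NormedAddCommGroup X]
    [NormedSpace 𝕜 X] (x : ℕ → X) : Prop :=
  (∃ M : ℝ, ∀ n, ‖x n‖ ≤ M) ∧ ∀ φ : ℕ → ℕ, StrictMono φ →
    ∃ ψ : ℕ → ℕ, StrictMono ψ ∧ SpansOrTendstoZero 𝕜 (x ∘ φ ∘ ψ)

theorem IsMeasureNull.comp {x : ℕ → X} (h : IsMeasureNull 𝕜 x) {φ : ℕ → ℕ} (hφ : StrictMono φ) :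
    IsMeasureNull 𝕜 (x ∘ φ) := by
  obtain ⟨⟨M, hM⟩, h⟩ := h
  exact ⟨⟨M, fun n => hM _⟩, fun ψ hψ => h (φ ∘ ψ) (hφ.comp hψ)⟩

theorem isMeasureNull_of_spansOrTendstoZero {x : ℕ → X} (hM : ∃ M : ℝ, ∀ n, ‖x n‖ ≤ M)
    (h : SpansOrTendstoZero 𝕜 x) : IsMeasureNull 𝕜 x :=
  ⟨hM, fun _ hφ => ⟨id, strictMono_id, h.comp hφ⟩⟩

theorem isMeasureNull_of_tendsto {x : ℕ → X} (h : Tendsto x atTop (𝓝 0)) :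
    IsMeasureNull 𝕜 x := by
  refine isMeasureNull_of_spansOrTendstoZero ?_
    (Or.inr (tendsto_zero_iff_norm_tendsto_zero.1 h))
  obtain ⟨M, hM⟩ := h.norm.bddAbove_range
  exact ⟨M, fun n => hM ⟨n, rfl⟩⟩

/-- The Urysohn property required by Kisyński's theorem. Boundedness is inherited because an
unbounded sequence has a subsequence with norms exceeding `n`, none of whose subsequences is
bounded. -/
theorem isMeasureNull_of_subseq {x : ℕ → X}
    (h : ∀ φ : ℕ → ℕ, StrictMono φ → ∃ ψ : ℕ → ℕ, StrictMono ψ ∧ IsMeasureNull 𝕜 (x ∘ φ ∘ ψ)) :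
    IsMeasureNull 𝕜 x := by
  constructor
  · by_contra! hub
    have hfreq : ∀ n : ℕ, ∃ᶠ k in atTop, (n : ℝ) < ‖x k‖ := by
      intro n hev
      have hev' : ∀ᶠ k in atTop, ‖x k‖ ≤ n := hev.mono fun k hk => not_lt.1 hk
      have hb : BddAbove (Set.range fun k => ‖x k‖) :=
        IsBoundedUnder.bddAbove_range (isBoundedUnder_of_eventually_le hev')
      obtain ⟨M, hM⟩ := hb
      obtain ⟨k, hk⟩ := hub M
      exact absurd (hM ⟨k, rfl⟩) (not_le.2 hk)
    obtain ⟨φ, hφ, hφx⟩ := extraction_forall_of_frequently hfreq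
    obtain ⟨ψ, hψ, ⟨M, hM⟩, -⟩ := h φ hφ
    obtain ⟨n, hn⟩ := exists_nat_gt M
    have h1 := hφx (ψ n)
    have h2 : (n : ℝ) ≤ ψ n := by exact_mod_cast hψ.id_le n
    have h3 : ‖x (φ (ψ n))‖ ≤ M := hM n
    linarith
  · intro φ hφ
    obtain ⟨ψ, hψ, -, hgood⟩ := h φ hφ
    obtain ⟨θ, hθ, hs⟩ := hgood id strictMono_id
    exact ⟨ψ ∘ θ, hψ.comp hθ, hs⟩

theorem IsAbstractMeasureTopology.tendsto_zero_iff {τ : TopologicalSpace X}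
    (hτ : IsAbstractMeasureTopology 𝕜 τ) {x : ℕ → X} :
    Tendsto x atTop (@nhds X τ 0) ↔ IsMeasureNull 𝕜 x := by
  constructor
  · intro h
    refine ⟨hτ.bounded_of_tendsto x h, fun φ hφ => ?_⟩
    obtain ⟨ψ, hψ, hs⟩ := hτ.subseq_of_tendsto (x ∘ φ) (h.comp hφ.tendsto_atTop)
    exact ⟨ψ, hψ, hs⟩
  · rintro ⟨⟨M, hM⟩, h⟩
    refine tendsto_of_subseq_tendsto fun ns hns => ?_
    obtain ⟨φ, hφ, hnφ⟩ := strictMono_subseq_of_tendsto_atTop hns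
    obtain ⟨ψ, hψ, hs⟩ := h (ns ∘ φ) hnφ
    refine ⟨φ ∘ ψ, ?_⟩
    rcases hs with hs | hs
    · exact hτ.tendsto_of_spans _ ⟨M, fun n => hM _⟩ hs
    · have hle : normTopology X ≤ τ := hτ.weaker_than_norm
      exact (tendsto_zero_iff_norm_tendsto_zero.2 hs).mono_right (nhds_mono hle)

theorem IsAbstractMeasureTopology.tendsto_iff {τ : TopologicalSpace X}
    (hτ : IsAbstractMeasureTopology 𝕜 τ) {x : ℕ → X} {a : X} :
    Tendsto x atTop (@nhds X τ a) ↔ IsMeasureNull 𝕜 fun n => x n - a :=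
  (hτ.translation_invariant x a).trans hτ.tendsto_zero_iff

theorem IsAbstractMeasureTopology.isClosed_iff {τ : TopologicalSpace X}
    (hτ : IsAbstractMeasureTopology 𝕜 τ) {A : Set X} : IsClosed[τ] A ↔
      ∀ (x : ℕ → X) (a : X), (∀ n, x n ∈ A) → IsMeasureNull 𝕜 (fun n => x n - a) → a ∈ A := by
  have := hτ.sequential
  rw [← isSeqClosed_iff_isClosed]
  exact ⟨fun h x a hx ha => h hx (hτ.tendsto_iff.2 ha),
    fun h x a hx ha => h x a hx (hτ.tendsto_iff.1 ha)⟩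

theorem IsAbstractMeasureTopology.eq {τ σ : TopologicalSpace X}
    (hτ : IsAbstractMeasureTopology 𝕜 τ) (hσ : IsAbstractMeasureTopology 𝕜 σ) : τ = σ :=
  TopologicalSpace.ext_isClosed fun _ => hτ.isClosed_iff.trans hσ.isClosed_iff.symm

variable [NormedSpace ℝ X] [IsScalarTower ℝ 𝕜 X]
  {P : StrongDual 𝕜 (StrongDual 𝕜 X) →L[𝕜] StrongDual 𝕜 (StrongDual 𝕜 X)}

/-- A singular weak-star limit point of a translated sequence determines the translation. -/
theorem IsLEmbeddingProjection.exists_weakStar_limit_of_isMeasureNull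
    (hP : IsLEmbeddingProjection 𝕜 X P) {x : ℕ → X} {a : X} {M : ℝ} (hM : ∀ n, ‖x n - a‖ ≤ M)
    (h : SpansOrTendstoZero 𝕜 fun n => x n - a) {l : Ultrafilter ℕ}
    (hl : (l : Filter ℕ) ≤ atTop) :
    ∃ w, P w = NormedSpace.inclusionInDoubleDual 𝕜 X a ∧
      Tendsto (fun n => StrongDual.toWeakDual (NormedSpace.inclusionInDoubleDual 𝕜 X (x n))) l
        (𝓝 (StrongDual.toWeakDual w)) := by
  obtain ⟨z, hz, hlim⟩ := hP.exists_singular_weakStar_limit hM h hl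
  refine ⟨z + NormedSpace.inclusionInDoubleDual 𝕜 X a, ?_, ?_⟩
  · rw [map_add P, hz, hP.apply_inclusion]
    ext
    simp
  · have := hlim.add (tendsto_const_nhds (x := StrongDual.toWeakDual
      (NormedSpace.inclusionInDoubleDual 𝕜 X a)))
    rw [map_add StrongDual.toWeakDual]
    refine this.congr fun n => ?_
    rw [← map_add StrongDual.toWeakDual, ← map_add, sub_add_cancel]

/-- On a common good subsequence, `P` sends one and the same ultrafilter limit both to `a` and to
`b`. -/
theorem IsLEmbeddingProjection.measureNull_limit_unique (hP : IsLEmbeddingProjection 𝕜 X P)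
    {x : ℕ → X} {a b : X} (ha : IsMeasureNull 𝕜 fun n => x n - a)
    (hb : IsMeasureNull 𝕜 fun n => x n - b) : a = b := by
  obtain ⟨⟨M, hM⟩, ha⟩ := ha
  obtain ⟨⟨N, hN⟩, hb⟩ := hb
  obtain ⟨φ, hφ, hφa⟩ := ha id strictMono_id
  obtain ⟨ψ, hψ, hψb⟩ := hb φ hφ
  have hψa := hφa.comp hψ
  have hl : (hyperfilter ℕ : Filter ℕ) ≤ atTop := Nat.hyperfilter_le_atTop
  obtain ⟨w, hw, hwlim⟩ := hP.exists_weakStar_limit_of_isMeasureNull (x := x ∘ φ ∘ ψ) (a := a)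
    (fun n => hM _) hψa hl
  obtain ⟨w', hw', hwlim'⟩ := hP.exists_weakStar_limit_of_isMeasureNull (x := x ∘ φ ∘ ψ) (a := b)
    (fun n => hN _) hψb hl
  have hww : w = w' := StrongDual.toWeakDual.injective (tendsto_nhds_unique hwlim hwlim')
  refine (NormedSpace.inclusionInDoubleDualLi (E := X) 𝕜).injective ?_
  exact hw.symm.trans ((congrArg P hww).trans hw')

theorem IsLEmbeddingProjection.exists_isAbstractMeasureTopology
    (hP : IsLEmbeddingProjection 𝕜 X P) :
    ∃ τ : TopologicalSpace X, IsAbstractMeasureTopology 𝕜 τ := by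
  let L : (ℕ → X) → X → Prop := fun x a => IsMeasureNull 𝕜 fun n => x n - a
  have hsub : ∀ x a (φ : ℕ → ℕ), StrictMono φ → L x a → L (x ∘ φ) a :=
    fun x a φ hφ h => h.comp hφ
  have hnorm : ∀ x a, Tendsto x atTop (𝓝 a) → L x a := fun x a h =>
    isMeasureNull_of_tendsto (by simpa using h.sub_const a)
  have hiff := tendsto_topologyOfConvergence_iff (L := L) (fun a => hnorm _ _ tendsto_const_nhds)
    hsub (fun x a b => hP.measureNull_limit_unique) fun x a h => isMeasureNull_of_subseq h
  have hiff0 : ∀ x, Tendsto x atTop (@nhds X (topologyOfConvergence L) 0) ↔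
      IsMeasureNull 𝕜 x := fun x => by simpa [L] using hiff x 0
  refine ⟨topologyOfConvergence L, ⟨sequentialSpace_topologyOfConvergence hsub, ?_, ?_, ?_, ?_, ?_,
    ?_⟩⟩
  · exact fun x a b ha hb => hP.measureNull_limit_unique ((hiff x a).1 ha) ((hiff x b).1 hb)
  · intro U hU
    rw [← isClosed_compl_iff, ← isSeqClosed_iff_isClosed]
    intro x a hx ha haU
    obtain ⟨n, hn⟩ := (hU x a (hnorm x a ha) haU).exists
    exact hx n hn
  · exact fun x a => (hiff x a).trans (hiff0 _).symm
  · exact fun x hM hx => (hiff0 x).2 (isMeasureNull_of_spansOrTendstoZero hM (Or.inl hx))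
  · exact fun x hx => ((hiff0 x).1 hx).1
  · exact fun x hx => ((hiff0 x).1 hx).2 id strictMono_id

end NullSequences

/-! ### Closedness of convex sets. -/

section ConvexSets

variable {𝕜 : Type*} [RCLike 𝕜] {X : Type*} [NormedAddCommGroup X] [NormedSpace 𝕜 X]
  [NormedSpace ℝ X] [IsScalarTower ℝ 𝕜 X]

/-- The case without singular part, where no `ℓ¹`-sequence is available: a positive distance from
`a` to `C` would bound `‖w - a‖` from below. -/
theorem mem_of_norm_sub_inclusion_eq_zero {C : Set X} (hC : Convex ℝ C) (hCn : IsClosed C)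
    {w : StrongDual 𝕜 (StrongDual 𝕜 X)} (hw : w ∈ weakStarClosureInBidual 𝕜 C) {a : X}
    (h0 : ‖w - NormedSpace.inclusionInDoubleDual 𝕜 X a‖ = 0) : a ∈ C := by
  refine hCn.closure_subset (Metric.mem_closure_iff.2 fun r hr => ?_)
  by_contra! hfar
  have := le_norm_of_mem_weakStarClosureInBidual (convex_image_sub hC a)
    (sub_mem_weakStarClosureInBidual hw a) (r := r) (by
      rintro _ ⟨c, hc, rfl⟩
      have := hfar c hc
      rwa [dist_comm, dist_eq_norm] at this)
  linarith

variable {P : StrongDual 𝕜 (StrongDual 𝕜 X) →L[𝕜] StrongDual 𝕜 (StrongDual 𝕜 X)}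
  {τ : TopologicalSpace X} {C : Set X}

theorem IsLEmbeddingProjection.isClosed_of_image_eq (hP : IsLEmbeddingProjection 𝕜 X P)
    (hτ : IsAbstractMeasureTopology 𝕜 τ)
    (h : P '' weakStarClosureInBidual 𝕜 C = NormedSpace.inclusionInDoubleDual 𝕜 X '' C) :
    IsClosed[τ] C := by
  refine hτ.isClosed_iff.2 fun x a hx ha => ?_
  obtain ⟨⟨M, hM⟩, ha⟩ := ha
  obtain ⟨φ, -, hφ⟩ := ha id strictMono_id
  obtain ⟨w, hw, hlim⟩ := hP.exists_weakStar_limit_of_isMeasureNull (x := x ∘ φ) (a := a)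
    (fun n => hM _) hφ Nat.hyperfilter_le_atTop
  have hwC : w ∈ weakStarClosureInBidual 𝕜 C :=
    mem_weakStarClosureInBidual_of_tendsto hlim (Eventually.of_forall fun n => hx _)
  obtain ⟨c, hc, hca⟩ : P w ∈ NormedSpace.inclusionInDoubleDual 𝕜 X '' C := h ▸ ⟨w, hwC, rfl⟩
  rw [hw] at hca
  rwa [← (NormedSpace.inclusionInDoubleDualLi (E := X) 𝕜).injective hca]

theorem IsLEmbeddingProjection.image_eq_of_isClosed (hP : IsLEmbeddingProjection 𝕜 X P)
    (hτ : IsAbstractMeasureTopology 𝕜 τ) (hCn : IsClosed[normTopology X] C) (hC : Convex ℝ C)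
    (h : IsClosed[τ] C) :
    P '' weakStarClosureInBidual 𝕜 C = NormedSpace.inclusionInDoubleDual 𝕜 X '' C := by
  refine Set.Subset.antisymm ?_ ?_
  · rintro _ ⟨w, hw, rfl⟩
    obtain ⟨a, ha⟩ := hP.exists_inclusion_eq w
    refine ⟨a, ?_, ha⟩
    have hzD := sub_mem_weakStarClosureInBidual hw a
    have hPz : P (w - NormedSpace.inclusionInDoubleDual 𝕜 X a) = 0 := by
      rw [map_sub P, hP.apply_inclusion, ha]
      ext
      simp
    rcases (norm_nonneg (w - NormedSpace.inclusionInDoubleDual 𝕜 X a)).eq_or_lt with h0 | h0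
    · exact mem_of_norm_sub_inclusion_eq_zero hC hCn hw h0.symm
    · obtain ⟨y, hyD, hyM, hspan⟩ :=
        hP.exists_spansEllOneAsymptotically (convex_image_sub hC a) hzD hPz h0
      choose c hc hcy using hyD
      refine hτ.isClosed_iff.1 h c a hc ?_
      rw [show (fun n => c n - a) = y from funext hcy]
      exact isMeasureNull_of_spansOrTendstoZero ⟨_, hyM⟩ (Or.inl hspan)
  · rintro _ ⟨c, hc, rfl⟩
    exact ⟨_, inclusion_mem_weakStarClosureInBidual hc, hP.apply_inclusion c⟩

end ConvexSets

theorem mainTheorem2 {𝕜 : Type*} [RCLike 𝕜] {X : Type*} [NormedAddCommGroup X]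
    [NormedSpace 𝕜 X] [NormedSpace ℝ X] [IsScalarTower ℝ 𝕜 X] [CompleteSpace X]
    (P : StrongDual 𝕜 (StrongDual 𝕜 X) →L[𝕜] StrongDual 𝕜 (StrongDual 𝕜 X))
    (hP : IsLEmbeddingProjection 𝕜 X P) :
    (∃! τ : TopologicalSpace X, IsAbstractMeasureTopology 𝕜 τ) ∧
    ∀ τμ : TopologicalSpace X, IsAbstractMeasureTopology 𝕜 τμ →
      ∀ C : Set X, IsClosed[normTopology X] C → Convex ℝ C →
        (Bornology.IsBounded C →
          (P '' weakStarClosureInBidual 𝕜 C = NormedSpace.inclusionInDoubleDual 𝕜 X '' C ↔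
            IsClosed[τμ] C)) ∧
        (IsClosed[τμ] C →
          P '' weakStarClosureInBidual 𝕜 C = NormedSpace.inclusionInDoubleDual 𝕜 X '' C) := by
  obtain ⟨τ, hτ⟩ := hP.exists_isAbstractMeasureTopology
  exact ⟨⟨τ, hτ, fun σ hσ => hσ.eq hτ⟩, fun τμ hτμ C hCn hC =>
    ⟨fun _ => ⟨hP.isClosed_of_image_eq hτμ, hP.image_eq_of_isClosed hτμ hCn hC⟩,
      hP.image_eq_of_isClosed hτμ hCn hC⟩⟩
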